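/- All graphs are finite and simple. A graph $G$ with at least two vertices is uniformly $3$-connected if, for every pair of distinct vertices $u,v$ of $G$, the maximum number of distinct, pairwise internally disjoint $u$–$v$ paths in $G$ is exactly $3$. A wheel with $n\ge 3$ spokes is a graph consisting of a cycle on $n$ vertices (the rim) together with one additional vertex (the hub) adjacent to every vertex of the cycle. If $G$ is a uniformly $3$-connected graph, then $$|E(G)| \le 2|V(G)| - 2.$$ Moreover, for a uniformly $3$-connected graph $G$, equality holds if and only if $G$ is (isomorphic to) a wheel with at least three spokes; and every wheel with at least three spokes is uniformly $3$-connected. -/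

import Mathlib

namespace SimpleGraph

/-- Two `u`–`v` paths are internally disjoint if they share no vertex other than `u` and `v`. -/
def InternallyDisjoint {V : Type*} {G : SimpleGraph V} {u v : V} (p q : G.Path u v) : Prop :=
  ∀ x : V, x ∈ (p : G.Walk u v).support → x ∈ (q : G.Walk u v).support → x = u ∨ x = v

/-- There are `n` distinct, pairwise internally disjoint paths from `u` to `v` in `G`. -/
def HasInternallyDisjointPaths {V : Type*} (G : SimpleGraph V) (u v : V) (n : ℕ) : Prop :=
  ∃ P : Fin n → G.Path u v,
    Function.Injective P ∧ Pairwise fun i j => InternallyDisjoint (P i) (P j)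

/-- `G` is uniformly `k`-connected if, for every two distinct vertices, the maximum number of
pairwise internally disjoint paths connecting them is exactly `k`. -/
def IsUniformlyConnected {V : Type*} (G : SimpleGraph V) (k : ℕ) : Prop :=
  ∀ u v : V, u ≠ v → IsGreatest {n : ℕ | G.HasInternallyDisjointPaths u v n} k

/-- Adjacency in the wheel with `n` spokes: the vertex `none` is the hub, and the vertices
`some i` form the rim, which is a cycle. -/
def wheelAdj (n : ℕ) : Option (Fin n) → Option (Fin n) → Prop
  | none, none => False
  | none, some _ => True
  | some _, none => True
  | some i, some j => (cycleGraph n).Adj i j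

/-- The wheel with `n` spokes: a cycle on `n` vertices together with one further vertex, the hub,
adjacent to all of them (a genuine wheel for `3 ≤ n`). -/
def wheelGraph (n : ℕ) : SimpleGraph (Option (Fin n)) where
  Adj := wheelAdj n
  symm := ⟨fun a b h => by
    cases a <;> cases b <;> first | exact h | exact SimpleGraph.Adj.symm h⟩
  loopless := ⟨fun a h => by
    cases a <;> first | exact h | exact (cycleGraph n).loopless.irrefl _ h⟩

/-- `G` is (isomorphic to) a wheel with at least three spokes. -/
def IsWheel {V : Type*} (G : SimpleGraph V) : Prop :=
  ∃ n : ℕ, 3 ≤ n ∧ Nonempty (G ≃g wheelGraph n)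

end SimpleGraph

/-! A mixed cut is a pair of disjoint vertex sets; its order counts the vertices outside both sets
and the edges between them. By Menger's theorem in this mixed form
(`hasInternallyDisjointPaths_of_le_cutOrder`), uniform 3-connectivity makes every mixed cut of
nonempty sides have order at least 3, and separates any two vertices by a cut of order at most 3.
`IsTight` keeps of the latter only the part concerning vertices of degree at least 4, because that
weaker property survives contraction.

The quantity to bound is the sum of 4 - deg v, which equals 4|V| - 2|E|; the claim is that it is at
least 4. If at most one vertex x has degree at least 4, all others have degree 3 and the sum is 4 +
(|V| - 1 - deg x). If there are two, uncrossing yields a cut consisting of exactly 3 edges with a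
large vertex on each side (`IsTight.exists_edge_cut`). Contracting either side gives a smaller tight
graph whose new vertex has degree 3 (`IsTight.collapse`), so by induction each side contributes at
least 4 - 1 = 3, and the sum is at least 6.

Equality therefore forces a vertex adjacent to all others, which have degree 3. Deleting it leaves a
connected 2-regular graph, that is, a cycle. Conversely, cuts in a wheel are checked directly and
Menger's theorem supplies the paths. -/

namespace SimpleGraph

/-! ### Mixed cuts, submodularity, and the existence of 3-edge cuts -/

section Cuts

open Finset
open scoped Classical

variable {V : Type*} (G : SimpleGraph V)

/-- The number of edges with first end in `A` and second end in `B`. -/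
noncomputable def crossing (A B : Finset V) : ℤ :=
  ∑ a ∈ A, ∑ b ∈ B, if G.Adj a b then 1 else 0

lemma crossing_comm (A B : Finset V) : G.crossing A B = G.crossing B A := by
  unfold crossing
  rw [sum_comm]
  simp only [G.adj_comm]

lemma crossing_mono {A A' B B' : Finset V} (hA : A ⊆ A') (hB : B ⊆ B') :
    G.crossing A B ≤ G.crossing A' B' := by
  unfold crossing
  refine (sum_le_sum fun a _ => sum_le_sum_of_subset_of_nonneg hB ?_).trans
    (sum_le_sum_of_subset_of_nonneg hA ?_)
  · intros; split_ifs <;> norm_num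
  · intros; exact sum_nonneg fun _ _ => by split_ifs <;> norm_num

lemma crossing_singleton_right_le_card (A : Finset V) (v : V) : G.crossing A {v} ≤ #A := by
  unfold crossing
  refine (sum_le_card_nsmul A _ 1 fun a _ => ?_).trans (by simp)
  rw [sum_singleton]; split_ifs <;> norm_num

lemma crossing_singleton_left_le_card (A : Finset V) (v : V) : G.crossing {v} A ≤ #A := by
  rw [crossing_comm]; exact G.crossing_singleton_right_le_card A v

lemma crossing_singleton_singleton (v w : V) :
    G.crossing {v} {w} = if G.Adj v w then 1 else 0 := by
  rw [crossing, sum_singleton, sum_singleton]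

lemma crossing_singleton_left (v : V) (A : Finset V) :
    G.crossing {v} A = #{w ∈ A | G.Adj v w} := by
  simp [crossing]

@[simp] lemma crossing_singleton_self (v : V) : G.crossing {v} {v} = 0 := by simp [crossing]

section

variable [Fintype V]

/-- The degree of a vertex, as an integer. -/
noncomputable def valency (v : V) : ℤ := G.crossing {v} univ

/-- The order of the mixed cut with sides `A` and `B`: the number of vertices outside both
sides plus the number of edges between the sides. -/
noncomputable def cutOrder (A B : Finset V) : ℤ :=
  Fintype.card V - #A - #B + G.crossing A B

lemma cutOrder_comm (A B : Finset V) : G.cutOrder A B = G.cutOrder B A := by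
  unfold cutOrder; rw [crossing_comm]; ring

/-- Mixed cuts have order at least three, and any two vertices of degree at least four are
separated by a mixed cut of order at most three. -/
structure IsTight : Prop where
  three_le : ∀ A B : Finset V, Disjoint A B → A.Nonempty → B.Nonempty → 3 ≤ G.cutOrder A B
  exists_cut : ∀ x y : V, x ≠ y → 4 ≤ G.valency x → 4 ≤ G.valency y →
    ∃ A B : Finset V, Disjoint A B ∧ x ∈ A ∧ y ∈ B ∧ G.cutOrder A B ≤ 3

end

variable [DecidableEq V]

lemma crossing_union_left {A A' : Finset V} (h : Disjoint A A') (B : Finset V) :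
    G.crossing (A ∪ A') B = G.crossing A B + G.crossing A' B :=
  sum_union h

lemma crossing_union_right (A : Finset V) {B B' : Finset V} (h : Disjoint B B') :
    G.crossing A (B ∪ B') = G.crossing A B + G.crossing A B' := by
  rw [crossing_comm, crossing_union_left G h, crossing_comm, G.crossing_comm B']

/-- Submodularity of the number of crossing edges. -/
lemma crossing_inter_union_le [Fintype V] (A A' B B' : Finset V) :
    G.crossing (A ∩ A') (B ∪ B') + G.crossing (A ∪ A') (B ∩ B') ≤
      G.crossing A B + G.crossing A' B' := by
  have key : ∀ A B : Finset V, G.crossing A B =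
      ∑ a, ∑ b, if a ∈ A ∧ b ∈ B ∧ G.Adj a b then 1 else 0 := by
    intro A B
    have : ∀ a, (∑ b, if a ∈ A ∧ b ∈ B ∧ G.Adj a b then (1 : ℤ) else 0) =
        if a ∈ A then ∑ b ∈ B, if G.Adj a b then 1 else 0 else 0 := by
      intro a
      by_cases h : a ∈ A
      · simp only [h, true_and, if_true, ite_and]
        rw [sum_ite_mem, univ_inter]
      · simp [h]
    simp only [this]
    rw [sum_ite_mem, univ_inter, crossing]
  rw [key, key, key, key, ← sum_add_distrib, ← sum_add_distrib]
  refine sum_le_sum fun a _ => ?_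
  rw [← sum_add_distrib, ← sum_add_distrib]
  refine sum_le_sum fun b _ => ?_
  by_cases h : G.Adj a b <;> by_cases h1 : a ∈ A <;> by_cases h2 : a ∈ A' <;>
    by_cases h3 : b ∈ B <;> by_cases h4 : b ∈ B' <;> simp [h, h1, h2, h3, h4]

variable [Fintype V]

lemma cutOrder_eq_card_compl_add_crossing {A B : Finset V} (hAB : Disjoint A B) :
    G.cutOrder A B = #(A ∪ B)ᶜ + G.crossing A B := by
  unfold cutOrder
  rw [card_compl, Nat.cast_sub (card_le_univ _), card_union_of_disjoint hAB]
  push_cast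
  ring

lemma cutOrder_inter_union_le (A A' B B' : Finset V) :
    G.cutOrder (A ∩ A') (B ∪ B') + G.cutOrder (A ∪ A') (B ∩ B') ≤
      G.cutOrder A B + G.cutOrder A' B' := by
  have h1 := G.crossing_inter_union_le A A' B B'
  have h2 := card_union_add_card_inter A A'
  have h3 := card_union_add_card_inter B B'
  unfold cutOrder
  zify at h2 h3
  linarith

lemma cutOrder_insert_right {A B : Finset V} {s : V} (hs : s ∉ B) :
    G.cutOrder A (insert s B) = G.cutOrder A B - 1 + G.crossing {s} A := by
  unfold cutOrder
  have : insert s B = B ∪ {s} := by ext; simp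
  rw [card_insert_of_notMem hs, this, crossing_union_right _ _ (by simpa using hs),
    G.crossing_comm A {s}]
  push_cast
  ring

lemma cutOrder_insert_left {A B : Finset V} {s : V} (hs : s ∉ A) :
    G.cutOrder (insert s A) B = G.cutOrder A B - 1 + G.crossing {s} B := by
  rw [cutOrder_comm, cutOrder_insert_right G hs, cutOrder_comm]

lemma valency_eq_add_compl (v : V) (A : Finset V) :
    G.valency v = G.crossing {v} A + G.crossing {v} Aᶜ := by
  rw [valency, ← crossing_union_right _ _ disjoint_compl_right, union_compl]

lemma cutOrder_compl (A : Finset V) : G.cutOrder A Aᶜ = G.crossing A Aᶜ := by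
  unfold cutOrder
  rw [card_compl, Nat.cast_sub (card_le_univ A)]
  ring

lemma cutOrder_singleton_compl (v : V) : G.cutOrder {v} {v}ᶜ = G.valency v := by
  rw [cutOrder_compl, valency_eq_add_compl G v {v}, crossing_singleton_self, zero_add]

variable {G}

/-- Two vertices of degree at least four are separated by three edges. -/
lemma IsTight.exists_edge_cut (hG : G.IsTight) {x y : V} (hxy : x ≠ y)
    (hx : 4 ≤ G.valency x) (hy : 4 ≤ G.valency y) :
    ∃ A : Finset V, (∃ x ∈ A, 4 ≤ G.valency x) ∧ (∃ y ∈ Aᶜ, 4 ≤ G.valency y) ∧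
      G.crossing A Aᶜ = 3 := by
  let F : Finset (Finset V × Finset V) := {C | Disjoint C.1 C.2 ∧ (∃ x ∈ C.1, 4 ≤ G.valency x) ∧
    (∃ y ∈ C.2, 4 ≤ G.valency y) ∧ G.cutOrder C.1 C.2 ≤ 3}
  have hF : F.Nonempty := by
    obtain ⟨A, B, h, hxA, hyB, hc⟩ := hG.exists_cut x y hxy hx hy
    exact ⟨(A, B), by simpa [F] using ⟨h, ⟨x, hxA, hx⟩, ⟨y, hyB, hy⟩, hc⟩⟩
  -- Since #A is at most |V|, this weight orders cuts lexicographically: #B first, then #A.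
  obtain ⟨⟨A, B⟩, hmem, hmax⟩ :=
    exists_max_image F (fun C => (Fintype.card V + 1) * #C.2 + #C.1) hF
  simp only [F, mem_filter, mem_univ, true_and, Prod.forall] at hmem hmax
  obtain ⟨hAB, ⟨x, hxA, hx⟩, ⟨y, hyB, hy⟩, hc⟩ := hmem
  have hB : ∀ A' B', Disjoint A' B' → (∃ x ∈ A', 4 ≤ G.valency x) →
      (∃ y ∈ B', 4 ≤ G.valency y) → G.cutOrder A' B' ≤ 3 → #B' ≤ #B := by
    intro A' B' h1 h2 h3 h4
    have := hmax A' B' ⟨h1, h2, h3, h4⟩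
    have hA := card_le_univ A
    by_contra! hlt
    nlinarith
  -- Moving s into one side changes the order by the number of its edges to the other side minus
  -- one, so by maximality s has two neighbours on each side. Hence s has degree at least 4 and can
  -- itself be separated from x; uncrossing the two cuts will enlarge B.
  have hfull : ∀ s ∉ A ∪ B, 2 ≤ G.crossing {s} A ∧ 2 ≤ G.crossing {s} B := by
    intro s hs
    rw [mem_union, not_or] at hs
    constructor
    · by_contra! hlt
      have := hB A (insert s B) (by simp [hAB, hs.1]) ⟨x, hxA, hx⟩
        ⟨y, mem_insert_of_mem hyB, hy⟩ (by rw [cutOrder_insert_right G hs.2]; linarith)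
      rw [card_insert_of_notMem hs.2] at this
      omega
    · by_contra! hlt
      have := hmax (insert s A) B ⟨by simp [hAB, hs.2], ⟨x, mem_insert_of_mem hxA, hx⟩,
        ⟨y, hyB, hy⟩, by rw [cutOrder_insert_left G hs.1]; linarith⟩
      rw [card_insert_of_notMem hs.1] at this
      omega
  by_cases hS : ∃ s, s ∉ A ∪ B
  swap
  · push Not at hS
    have hBA : B = Aᶜ := by
      ext v
      have := hS v
      rw [mem_union] at this
      rw [mem_compl]
      exact ⟨fun h h' => Finset.disjoint_left.1 hAB h' h, fun h => this.resolve_left h⟩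
    subst hBA
    refine ⟨A, ⟨x, hxA, hx⟩, ⟨y, hyB, hy⟩, ?_⟩
    rw [← cutOrder_compl]
    exact le_antisymm hc (hG.three_le _ _ hAB ⟨x, hxA⟩ ⟨y, hyB⟩)
  obtain ⟨s, hs⟩ := hS
  obtain ⟨hsA, hsB⟩ := hfull s hs
  rw [mem_union, not_or] at hs
  have hs4 : 4 ≤ G.valency s := by
    have := G.crossing_mono (Subset.refl {s}) (subset_univ (A ∪ B))
    rw [crossing_union_right _ _ hAB] at this
    unfold valency
    linarith
  obtain ⟨A', B', hAB', hxA', hsB', hc'⟩ :=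
    hG.exists_cut x s (fun h => hs.1 (h ▸ hxA)) hx hs4
  have hdisj : Disjoint (A ∩ A') (B ∪ B') := by
    rw [disjoint_union_right]
    exact ⟨hAB.mono_left inter_subset_left, hAB'.mono_left inter_subset_right⟩
  have hnew : G.cutOrder (A ∩ A') (B ∪ B') ≤ 3 := by
    by_cases hBB : (B ∩ B').Nonempty
    · have h1 := G.cutOrder_inter_union_le A A' B B'
      have h2 := hG.three_le (A ∪ A') (B ∩ B') (by
        rw [disjoint_union_left]
        exact ⟨hAB.mono_right inter_subset_left, hAB'.mono_right inter_subset_right⟩)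
        ⟨x, mem_union_left _ hxA⟩ hBB
      linarith
    -- With B ∩ B' empty, the companion cut has an empty side and no lower bound, so submodularity
    -- alone does not suffice. The two or more edges from s to B replace it: those ending in A' are
    -- lost from the count of edges between A' and B', the others end at vertices outside A ∪ A'.
    rw [not_nonempty_iff_eq_empty, ← disjoint_iff_inter_eq_empty] at hBB
    have e1 : G.crossing (A ∩ A') B ≤ G.crossing A B :=
      G.crossing_mono inter_subset_left (Subset.refl _)
    have e2 : G.crossing (A ∩ A') B' + G.crossing (B ∩ A') {s} ≤ G.crossing A' B' := by
      have hd : Disjoint (A ∩ A') (B ∩ A') :=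
        hAB.mono inter_subset_left inter_subset_left
      have := G.crossing_mono (union_subset inter_subset_right inter_subset_right :
        (A ∩ A') ∪ (B ∩ A') ⊆ A') (Subset.refl B')
      rw [crossing_union_left _ hd] at this
      have := G.crossing_mono (Subset.refl (B ∩ A')) (singleton_subset_iff.2 hsB')
      linarith
    have e3 : G.crossing {s} B ≤ #(B \ A') + G.crossing (B ∩ A') {s} := by
      rw [crossing_comm, ← sdiff_union_inter B A', crossing_union_left _
        (disjoint_sdiff_inter B A'), sdiff_union_inter]
      linarith [G.crossing_singleton_right_le_card (B \ A') s]
    have e4 : #(A ∪ A') + #(B \ A') + 1 ≤ Fintype.card V := by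
      have hd : Disjoint (A ∪ A') (insert s (B \ A')) := by
        rw [disjoint_insert_right, disjoint_union_left, mem_union, not_or]
        exact ⟨⟨hs.1, fun h => Finset.disjoint_left.1 hAB' h hsB'⟩, hAB.mono_right sdiff_subset,
          disjoint_sdiff⟩
      have := card_le_univ ((A ∪ A') ∪ insert s (B \ A'))
      rwa [card_union_of_disjoint hd, card_insert_of_notMem (fun h => hs.2 (mem_sdiff.1 h).1),
        ← add_assoc] at this
    have e5 := card_union_add_card_inter A A'
    unfold cutOrder at hc hc' ⊢
    rw [crossing_union_right _ _ hBB, card_union_of_disjoint hBB]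
    zify at e4 e5
    push_cast
    linarith
  have hlt := hB (A ∩ A') (B ∪ B') hdisj ⟨x, mem_inter.2 ⟨hxA, hxA'⟩, hx⟩
    ⟨y, mem_union_left _ hyB, hy⟩ hnew
  have : B ⊂ B ∪ B' := ⟨subset_union_left, fun h => hs.2 (h (mem_union_right _ hsB'))⟩
  exact absurd (card_lt_card this) (by omega)

end Cuts

section

open Finset
open scoped Classical

variable {V : Type*} [Fintype V] (G : SimpleGraph V)

lemma valency_le_card_sub_one (v : V) : G.valency v ≤ Fintype.card V - 1 := by
  rw [valency_eq_add_compl G v {v}, crossing_singleton_self, zero_add]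
  refine (G.crossing_singleton_left_le_card _ v).trans ?_
  rw [card_compl, card_singleton, Nat.cast_sub (Fintype.card_pos_iff.2 ⟨v⟩), Nat.cast_one]

variable {G}

lemma IsTight.three_le_valency [Nontrivial V] (hG : G.IsTight) (v : V) : 3 ≤ G.valency v := by
  rw [← cutOrder_singleton_compl]
  obtain ⟨w, hw⟩ := exists_ne v
  exact hG.three_le _ _ disjoint_compl_right (by simp) ⟨w, by simpa using hw⟩

end

/-! ### Menger's theorem for mixed cuts -/

section Menger

open Finset
open scoped Classical

variable {V : Type*} [Fintype V] {G : SimpleGraph V}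

lemma cutOrder_eq_card_add_card [DecidableEq V] {A B : Finset V} (hAB : Disjoint A B) :
    G.cutOrder A B = #(A ∪ B)ᶜ + #{e ∈ A ×ˢ B | G.Adj e.1 e.2} := by
  rw [cutOrder_eq_card_compl_add_crossing G hAB, crossing, card_filter, sum_product]
  push_cast
  rfl

/-- The number of internally disjoint paths is at most the order of any separating mixed cut. -/
lemma HasInternallyDisjointPaths.le_cutOrder {u v : V} {n : ℕ}
    (h : G.HasInternallyDisjointPaths u v n) {A B : Finset V} (hAB : Disjoint A B)
    (hu : u ∈ A) (hv : v ∈ B) : (n : ℤ) ≤ G.cutOrder A B := by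
  obtain ⟨P, hinj, hdis⟩ := h
  have hvA : v ∉ A := fun h => Finset.disjoint_left.1 hAB h hv
  have huB : u ∉ B := fun h => Finset.disjoint_left.1 hAB hu h
  choose d hd hdA hdA' using fun i =>
    (P i : G.Walk u v).exists_boundary_dart (A : Set V) (by simpa using hu) (by simpa using hvA)
  simp only [SetLike.mem_coe] at hdA hdA'
  let Z : Finset (V ⊕ V × V) :=
    (A ∪ B)ᶜ.disjSum ({e ∈ A ×ˢ B | G.Adj e.1 e.2} : Finset (V × V))
  -- Each path is charged, where it leaves A, either to an edge of the cut or to a vertex outside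
  -- both sides. Two paths sharing a charged edge would both be the single edge uv, contradicting
  -- distinctness.
  let g : Fin n → V ⊕ V × V := fun i =>
    if (d i).snd ∈ B then Sum.inr ((d i).fst, (d i).snd) else Sum.inl (d i).snd
  have hg : ∀ i ∈ (univ : Finset (Fin n)), g i ∈ Z := by
    intro i _
    by_cases hi : (d i).snd ∈ B
    · simp [g, Z, hi, hdA i, (d i).adj]
    · simp [g, Z, hi, hdA' i]
  have hfst := fun i => (P i : G.Walk u v).dart_fst_mem_support_of_mem_darts (hd i)
  have hsnd := fun i => (P i : G.Walk u v).dart_snd_mem_support_of_mem_darts (hd i)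
  have hgi : Function.Injective g := by
    intro i j hij
    by_contra hne
    have hdij := hdis hne
    by_cases hi : (d i).snd ∈ B <;> by_cases hj : (d j).snd ∈ B <;>
      simp only [g, hi, hj, if_true, if_false, Sum.inr.injEq, Sum.inl.injEq, Prod.mk.injEq,
        reduceCtorEq] at hij
    · have h1 : (d i).fst = u := (hdij _ (hfst i) (hij.1 ▸ hfst j)).resolve_right
        fun h => hvA (h ▸ hdA i)
      have h2 : (d i).snd = v := (hdij _ (hsnd i) (hij.2 ▸ hsnd j)).resolve_left
        fun h => huB (h ▸ hi)
      have key : ∀ l, (d l).fst = u → (d l).snd = v →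
          s(u, v) ∈ (P l : G.Walk u v).edges := by
        intro l e1 e2
        rw [Walk.edges, List.mem_map]
        exact ⟨d l, hd l, by rw [← e1, ← e2]; rfl⟩
      apply hne
      apply hinj
      ext1
      rw [(P i).2.eq_adj_toWalk_of_mem_edges (key i h1 h2),
        (P j).2.eq_adj_toWalk_of_mem_edges (key j (hij.1 ▸ h1) (hij.2 ▸ h2))]
    · rcases hdij _ (hsnd i) (hij ▸ hsnd j) with h | h
      · exact hdA' i (h ▸ hu)
      · exact hi (h ▸ hv)
  have := card_le_card_of_injOn g hg hgi.injOn
  rw [card_univ, Fintype.card_fin, card_disjSum] at this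
  rw [cutOrder_eq_card_add_card hAB]
  exact_mod_cast this

/-- The bipartite relation whose perfect matchings encode systems of `k` internally disjoint
paths from `x` to `y`. -/
def linkage (G : SimpleGraph V) (x y : V) (k : ℕ) : Fin k ⊕ V → Fin k ⊕ V → Prop
  -- On the left `inl` stands for k copies of x, on the right for k copies of y. Restricting to
  -- index 0 lets the edge xy be used only once.
  | .inl i, .inl j => G.Adj x y ∧ i.val = 0 ∧ j.val = 0
  | .inl _, .inr v => G.Adj x v ∧ v ≠ y
  | .inr v, .inl _ => v ≠ x ∧ v ≠ y ∧ G.Adj v y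
  -- A vertex matched to itself is one that no path uses.
  | .inr v, .inr w => w = v ∨ (v ≠ x ∧ v ≠ y ∧ w ≠ x ∧ w ≠ y ∧ G.Adj v w)

lemma exists_injective_linkage {x y : V} (hxy : x ≠ y) {k : ℕ}
    (hcut : ∀ A B : Finset V, Disjoint A B → x ∈ A → y ∈ B → (k : ℤ) ≤ G.cutOrder A B) :
    ∃ f : Fin k ⊕ V → Fin k ⊕ V, Function.Injective f ∧ ∀ l, G.linkage x y k l (f l) := by
  let t : Fin k ⊕ V → Finset (Fin k ⊕ V) := fun l => {r | G.linkage x y k l r}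
  suffices h : ∀ X : Finset (Fin k ⊕ V), #X ≤ #(X.biUnion t) by
    obtain ⟨f, hf, hft⟩ := (Finset.all_card_le_biUnion_card_iff_exists_injective t).1 h
    exact ⟨f, hf, fun l => by simpa [t] using hft l⟩
  intro X
  set N := X.biUnion t with hN
  have hmem : ∀ r, r ∈ N ↔ ∃ l ∈ X, G.linkage x y k l r := by simp [hN, t]
  have hW : X.toRight ⊆ N.toRight := by
    intro v hv
    rw [mem_toRight] at hv ⊢
    exact (hmem _).2 ⟨_, hv, Or.inl rfl⟩
  have hXc := X.card_toLeft_add_card_toRight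
  have hNc := N.card_toLeft_add_card_toRight
  have hWc := card_le_card hW
  have hk := X.toLeft.card_le_univ
  rw [Fintype.card_fin] at hk
  by_cases h0 : X.toLeft.Nonempty
  swap
  · rw [not_nonempty_iff_eq_empty] at h0
    rw [h0, card_empty] at hXc
    omega
  obtain ⟨i, hi⟩ := h0
  rw [mem_toLeft] at hi
  by_cases hy : ∃ v, Sum.inr v ∈ X ∧ v ≠ x ∧ v ≠ y ∧ G.Adj v y
  · obtain ⟨v, hvX, hv⟩ := hy
    have : N.toLeft = univ := by
      ext j
      simp only [mem_toLeft, mem_univ, iff_true]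
      exact (hmem _).2 ⟨_, hvX, hv⟩
    rw [this, card_univ, Fintype.card_fin] at hNc
    omega
  push Not at hy
  -- The cut read off from X: A is what X reaches from, B is what its neighbourhood N misses. The
  -- only possible edge between them is xy, and the vertices outside both lie in N but not in X.
  let A : Finset V := insert x (X.toRight \ {x, y})
  let B : Finset V := insert y (N.toRight ∪ {x})ᶜ
  have hxB : x ∉ B := by simp [B, hxy]
  have hAB : Disjoint A B := by
    rw [Finset.disjoint_left]
    intro a ha hb
    simp only [A, B, mem_insert, mem_sdiff, mem_singleton, not_or, mem_compl, mem_union] at ha hb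
    rcases ha with rfl | ⟨ha, hax, hay⟩
    · rcases hb with h | h
      · exact hxy h
      · exact h.2 rfl
    · rcases hb with h | h
      · exact hay h
      · exact h.1 (hW ha)
  have hZ : (A ∪ B)ᶜ ⊆ N.toRight \ X.toRight := by
    intro v hv
    simp only [A, B, mem_compl, mem_union, mem_insert, mem_sdiff, mem_singleton, not_or,
      not_and, not_not] at hv ⊢
    obtain ⟨⟨h1, h2⟩, h3, h4⟩ := hv
    refine ⟨by_contra fun h => h1 (h4 h), fun h => h3 (h2 h h1)⟩
  have hcr : G.crossing A B ≤ G.crossing {x} {y} := by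
    unfold crossing
    simp only [← sum_product']
    rw [← sum_filter, ← sum_filter]
    refine sum_le_sum_of_subset_of_nonneg ?_ (fun _ _ _ => zero_le_one)
    rintro ⟨a, b⟩ hab
    simp only [mem_filter, mem_product, mem_singleton] at hab ⊢
    obtain ⟨⟨ha, hb⟩, hadj⟩ := hab
    refine ⟨?_, hadj⟩
    have hbx : b ≠ x := fun h => hxB (h ▸ hb)
    simp only [A, B, mem_insert, mem_sdiff, mem_singleton, not_or, mem_compl, mem_union,
      mem_toRight] at ha hb
    rcases ha with rfl | ⟨ha, hax, hay⟩
    · refine ⟨rfl, ?_⟩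
      rcases hb with h | h
      · exact h
      · by_contra hby
        exact h.1 ((hmem _).2 ⟨_, hi, hadj, hby⟩)
    · exfalso
      by_cases hby : b = y
      · exact hy a ha hax hay (hby ▸ hadj)
      · rcases hb with h | h
        · exact hby h
        · exact h.1 ((hmem _).2 ⟨_, ha, Or.inr ⟨hax, hay, hbx, hby, hadj⟩⟩)
  have hord := hcut A B hAB (mem_insert_self _ _) (mem_insert_self _ _)
  have heq := G.cutOrder_eq_card_compl_add_crossing hAB
  have hsd := card_sdiff_add_card_eq_card hW
  have hZc := card_le_card hZ
  rw [crossing_singleton_singleton] at hcr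
  by_cases hadj : G.Adj x y
  · rw [if_pos hadj] at hcr
    have hk' : k ≤ #(N.toRight \ X.toRight) + 1 := by zify at hZc ⊢; linarith
    -- The edge xy costs one in the count. It is recovered from the copy of y with index 0 in N, or
    -- from the copy of x with index 0 missing from X.
    by_cases hz : ∃ j : Fin k, j.val = 0 ∧ Sum.inl j ∈ X
    · obtain ⟨j, hj, hjX⟩ := hz
      have : 0 < #N.toLeft := card_pos.2
        ⟨j, by rw [mem_toLeft]; exact (hmem _).2 ⟨_, hjX, hadj, hj, hj⟩⟩
      omega
    · push Not at hz
      have : #X.toLeft < k := by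
        conv_rhs => rw [← Fintype.card_fin k]
        refine card_lt_univ_of_notMem (x := (⟨0, i.pos⟩ : Fin k)) ?_
        rw [mem_toLeft]
        exact hz _ rfl
      omega
  · rw [if_neg hadj] at hcr
    have hk' : k ≤ #(N.toRight \ X.toRight) := by zify at hZc ⊢; linarith
    omega

/-- Menger's theorem for mixed cuts. -/
theorem hasInternallyDisjointPaths_of_le_cutOrder {x y : V} (hxy : x ≠ y) {k : ℕ}
    (hcut : ∀ A B : Finset V, Disjoint A B → x ∈ A → y ∈ B → (k : ℤ) ≤ G.cutOrder A B) :
    G.HasInternallyDisjointPaths x y k := by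
  obtain ⟨f, hinj, hf⟩ := exists_injective_linkage hxy hcut
  let r : V → V → Prop := fun v w => f (.inr v) = .inr w
  let O : Fin k → V → Prop := fun i w => ∃ v, f (.inl i) = .inr v ∧ Relation.ReflTransGen r v w
  have hr : ∀ {v w}, r v w → w = v ∨ (v ≠ x ∧ v ≠ y ∧ w ≠ x ∧ w ≠ y ∧ G.Adj v w) := by
    intro v w h
    have := hf (.inr v)
    rwa [show f (.inr v) = .inr w from h] at this
  have hstart : ∀ {i v}, f (.inl i) = .inr v → G.Adj x v ∧ v ≠ y := by
    intro i v h
    have := hf (.inl i)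
    rwa [h] at this
  have hOne : ∀ {i w}, O i w → w ≠ x ∧ w ≠ y := by
    rintro i w ⟨v, hv, hvw⟩
    induction hvw with
    | refl => exact ⟨(hstart hv).1.ne', (hstart hv).2⟩
    | tail _ h ih =>
      rcases hr h with rfl | h
      · exact ih
      · exact ⟨h.2.2.1, h.2.2.2.1⟩
  -- Injectivity of `f` allows orbits to be traced backwards, so different starts have disjoint
  -- orbits.
  have hOinj : ∀ {i j w}, O i w → O j w → i = j := by
    rintro i j w ⟨v, hv, hvw⟩ hj
    induction hvw with
    | refl =>
      obtain ⟨v', hv', h⟩ := hj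
      rcases h.cases_tail with rfl | ⟨c, _, hc⟩
      · exact Sum.inl_injective (hinj (hv.trans hv'.symm))
      · exact absurd (hinj (hv.trans (show f (.inr c) = _ from hc).symm)) Sum.inl_ne_inr
    | @tail b c _ hbc ih =>
      obtain ⟨v', hv', h⟩ := hj
      rcases h.cases_tail with rfl | ⟨b', hb', hc⟩
      · exact absurd (hinj (hv'.trans (show f (.inr b) = _ from hbc).symm)) Sum.inl_ne_inr
      · have : b' = b := Sum.inr_injective (hinj ((show f (.inr b') = _ from hc).trans
          (show f (.inr b) = _ from hbc).symm))
        exact ih ⟨v', hv', this ▸ hb'⟩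
  -- An orbit that never reached a copy of y would, together with its start, be mapped injectively
  -- into itself, a set with one element fewer.
  have hexit : ∀ {i v}, f (.inl i) = .inr v → ∃ w, O i w ∧ ∃ j, f (.inr w) = .inl j := by
    intro i v hv
    by_contra! hcon
    let S : Finset V := {w | O i w}
    have hmaps : ∀ l ∈ insert (Sum.inl i) (S.map .inr), f l ∈ S.map .inr := by
      intro l hl
      rw [mem_insert, mem_map] at hl
      rcases hl with rfl | ⟨w, hw, rfl⟩
      · rw [hv]
        exact mem_map_of_mem Function.Embedding.inr
          (by simpa [S] using (⟨v, hv, .refl⟩ : O i v))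
      · have hw' : O i w := by simpa [S] using hw
        obtain ⟨v', hv', h⟩ := hw'
        rcases hfw : f (.inr w) with j | w'
        · exact absurd hfw (hcon w ⟨v', hv', h⟩ j)
        · rw [show f (Function.Embedding.inr w) = _ from hfw]
          exact mem_map_of_mem Function.Embedding.inr
            (by simpa [S] using (⟨v', hv', h.tail hfw⟩ : O i w'))
    have := card_le_card_of_injOn f hmaps hinj.injOn
    rw [card_insert_of_notMem (by simp)] at this
    omega
  have hwalk : ∀ {v w}, Relation.ReflTransGen r v w →
      ∃ q : G.Walk v w, ∀ z ∈ q.support, Relation.ReflTransGen r v z := by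
    intro v w h
    induction h with
    | refl => exact ⟨.nil, by simp [Relation.ReflTransGen.refl]⟩
    | @tail b c hb hbc ih =>
      obtain ⟨q, hq⟩ := ih
      rcases hr hbc with rfl | h
      · exact ⟨q, hq⟩
      · refine ⟨q.concat h.2.2.2.2, fun z hz => ?_⟩
        rw [Walk.support_concat, List.mem_append, List.mem_singleton] at hz
        rcases hz with hz | rfl
        · exact hq z hz
        · exact hb.tail hbc
  have hpath : ∀ i, ∃ p : G.Path x y, (∀ z ∈ (p : G.Walk x y).support, z = x ∨ z = y ∨ O i z) ∧
      (s(x, y) ∈ (p : G.Walk x y).edges → i.val = 0) := by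
    intro i
    rcases hfi : f (.inl i) with j | v
    · have h := hf (.inl i)
      rw [hfi] at h
      refine ⟨.singleton h.1, fun z hz => ?_, fun _ => h.2.1⟩
      simp only [Path.singleton, Walk.support_cons, Walk.support_nil, List.mem_cons,
        List.not_mem_nil, or_false] at hz
      tauto
    · obtain ⟨w, ⟨v', hv', hvw⟩, j, hj⟩ := hexit hfi
      obtain rfl : v = v' := Sum.inr_injective (hfi.symm.trans hv')
      obtain ⟨q, hq⟩ := hwalk hvw
      have hwy := hf (.inr w)
      rw [hj] at hwy
      have hqO : ∀ z ∈ q.support, O i z := fun z hz => ⟨v, hfi, hq z hz⟩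
      let p : G.Walk x y := .cons (hstart hfi).1 (q.concat hwy.2.2)
      refine ⟨p.toPath, fun z hz => ?_, fun he => ?_⟩
      · have := p.support_toPath_subset_support hz
        simp only [p, Walk.support_cons, Walk.support_concat, List.mem_cons,
          List.mem_append, List.not_mem_nil, or_false] at this
        rcases this with h | h | h
        · exact .inl h
        · exact .inr (.inr (hqO z h))
        · exact .inr (.inl h)
      · exfalso
        have := p.edges_bypass_subset_edges he
        simp only [p, Walk.edges_cons, Walk.edges_concat, List.mem_cons,
          List.concat_eq_append, List.mem_append, List.not_mem_nil, or_false] at this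
        rcases this with h | h | h
        · rw [Sym2.congr_right] at h
          exact (hstart hfi).2 h.symm
        · exact (hOne (hqO x (q.fst_mem_support_of_mem_edges h))).1 rfl
        · rw [Sym2.congr_left] at h
          exact hwy.1 h.symm
  choose P hP hP0 using hpath
  have hdis : Pairwise fun i j => InternallyDisjoint (P i) (P j) := by
    intro i j hij z hzi hzj
    rcases hP i z hzi with h | h | h
    · exact .inl h
    · exact .inr h
    rcases hP j z hzj with h' | h' | h'
    · exact .inl h'
    · exact .inr h'
    exact absurd (hOinj h h') hij
  -- Equal paths with different indices would have no inner vertex, hence use the edge xy, which is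
  -- reserved for index 0.
  refine ⟨P, fun i j hPij => ?_, hdis⟩
  by_contra hij
  have hsup : ∀ z ∈ (P i : G.Walk x y).support, z = x ∨ z = y :=
    fun z hz => hdis hij z hz (hPij ▸ hz)
  have hedge : s(x, y) ∈ (P i : G.Walk x y).edges := by
    generalize (P i : G.Walk x y) = p at hsup
    cases p with
    | nil => exact absurd rfl hxy
    | @cons _ w _ h q =>
      rcases hsup w (by simp) with rfl | rfl
      · exact absurd h (G.irrefl)
      · simp
  exact hij (Fin.ext ((hP0 i hedge).trans (hP0 j (hPij ▸ hedge)).symm))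

/-- A uniformly 3-connected graph is tight. -/
lemma IsUniformlyConnected.isTight (hG : G.IsUniformlyConnected 3) : G.IsTight where
  three_le A B hAB := by
    rintro ⟨u, hu⟩ ⟨v, hv⟩
    exact (hG u v fun h => Finset.disjoint_left.1 hAB hu (h ▸ hv)).1.le_cutOrder hAB hu hv
  exists_cut x y hxy _ _ := by
    by_contra! hcon
    have := (hG x y hxy).2 (hasInternallyDisjointPaths_of_le_cutOrder (k := 4) hxy
      fun A B hAB hx hy => by have := hcon A B hAB hx hy; push_cast; linarith)
    omega

end Menger

/-! ### Contracting one side of a 3-edge cut -/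

section Collapse

open Finset
open scoped Classical

universe u

variable {V : Type u} [Fintype V] (G : SimpleGraph V) (A : Finset V)

/-- The vertices of `G` represented by a vertex of the graph `G.collapse A`. -/
noncomputable def fiber : Option A → Finset V
  | none => Aᶜ
  | some a => {a.1}

/-- The graph obtained from `G` by contracting the complement of `A` to one vertex `none`. -/
def collapse : SimpleGraph (Option A) where
  Adj p q := p ≠ q ∧ ∃ u ∈ fiber A p, ∃ v ∈ fiber A q, G.Adj u v
  symm := ⟨fun _ _ ⟨h, u, hu, v, hv, huv⟩ => ⟨h.symm, v, hv, u, hu, huv.symm⟩⟩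
  loopless := ⟨fun _ h => h.1 rfl⟩

/-- The union of the fibers of a set of vertices of `G.collapse A`. -/
noncomputable def lift (P : Finset (Option A)) : Finset V := P.biUnion (fiber A)

variable {A}

lemma disjoint_fiber {p q : Option A} (h : p ≠ q) : Disjoint (fiber A p) (fiber A q) := by
  rcases p with _ | a <;> rcases q with _ | b
  · exact absurd rfl h
  · simp [fiber]
  · simp [fiber]
  · simp only [fiber, disjoint_singleton]
    exact fun hab => h (congrArg some (Subtype.ext hab))

lemma exists_mem_fiber (v : V) : ∃ p : Option A, v ∈ fiber A p := by
  by_cases h : v ∈ A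
  · exact ⟨some ⟨v, h⟩, by simp [fiber]⟩
  · exact ⟨none, by simpa [fiber] using h⟩

lemma disjoint_lift {P Q : Finset (Option A)} (h : Disjoint P Q) :
    Disjoint (lift A P) (lift A Q) := by
  rw [lift, lift, disjoint_biUnion_left]
  intro p hp
  rw [disjoint_biUnion_right]
  exact fun q hq => disjoint_fiber fun hpq => Finset.disjoint_left.1 h hp (hpq ▸ hq)

lemma lift_compl (P : Finset (Option A)) : lift A Pᶜ = (lift A P)ᶜ := by
  ext v
  rw [mem_compl]
  constructor
  · exact fun h h' => Finset.disjoint_left.1 (disjoint_lift disjoint_compl_left) h h'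
  · intro h
    obtain ⟨p, hp⟩ := exists_mem_fiber (A := A) v
    refine mem_biUnion.2 ⟨p, mem_compl.2 fun hpP => h (mem_biUnion.2 ⟨p, hpP, hp⟩), hp⟩

lemma lift_nonempty (hA : Aᶜ.Nonempty) {P : Finset (Option A)} (hP : P.Nonempty) :
    (lift A P).Nonempty := by
  obtain ⟨p, hp⟩ := hP
  rw [lift, biUnion_nonempty]
  refine ⟨p, hp, ?_⟩
  cases p with
  | none => exact hA
  | some a => exact singleton_nonempty _

lemma card_lift (P : Finset (Option A)) :
    (#(lift A P) : ℤ) = #P + if none ∈ P then (#Aᶜ : ℤ) - 1 else 0 := by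
  rw [lift, card_biUnion fun p _ q _ h => disjoint_fiber h]
  have : ∀ p : Option A, (#(fiber A p) : ℤ) = 1 + if p = none then (#Aᶜ : ℤ) - 1 else 0 := by
    rintro (_ | a) <;> simp [fiber]
  push_cast
  simp only [this, sum_add_distrib, sum_ite_eq']
  simp

/-- The hypothesis rules out parallel edges at the contracted vertex, so passing to a simple graph
loses no edge. -/
lemma crossing_lift (hA : ∀ a ∈ A, G.crossing {a} Aᶜ ≤ 1) {P Q : Finset (Option A)}
    (h : Disjoint P Q) : G.crossing (lift A P) (lift A Q) = (G.collapse A).crossing P Q := by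
  have hsum : ∀ (P : Finset (Option A)) (B : Finset V),
      G.crossing (lift A P) B = ∑ p ∈ P, G.crossing (fiber A p) B :=
    fun P B => sum_biUnion fun p _ q _ h => disjoint_fiber h
  rw [hsum, crossing]
  refine sum_congr rfl fun p hp => ?_
  rw [crossing_comm, hsum]
  refine sum_congr rfl fun q hq => ?_
  have hpq : p ≠ q := fun hpq => Finset.disjoint_left.1 h hp (hpq ▸ hq)
  have hle : G.crossing (fiber A q) (fiber A p) ≤ 1 := by
    rcases p with _ | a <;> rcases q with _ | b
    · exact absurd rfl hpq
    · exact hA b b.2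
    · rw [crossing_comm]; exact hA a a.2
    · simp only [fiber, crossing_singleton_singleton]
      split_ifs <;> norm_num
  split_ifs with hadj
  · obtain ⟨_, u, hu, v, hv, huv⟩ := hadj
    refine le_antisymm hle ?_
    have := G.crossing_mono (singleton_subset_iff.2 hv) (singleton_subset_iff.2 hu)
    rwa [crossing_singleton_singleton, if_pos huv.symm] at this
  · refine sum_eq_zero fun v hv => sum_eq_zero fun u hu => if_neg fun huv => hadj ?_
    exact ⟨hpq, u, hu, v, hv, huv.symm⟩

/-- The correction appears when `none` lies outside both sides: it then counts as one vertex, its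
fiber as #Aᶜ. -/
lemma cutOrder_lift (hA : ∀ a ∈ A, G.crossing {a} Aᶜ ≤ 1) {P Q : Finset (Option A)}
    (h : Disjoint P Q) : G.cutOrder (lift A P) (lift A Q) = (G.collapse A).cutOrder P Q +
      if none ∈ P ∪ Q then 0 else (#Aᶜ : ℤ) - 1 := by
  have hc : (Fintype.card V : ℤ) = #A + #Aᶜ := by
    rw [← Nat.cast_add, card_add_card_compl]
  unfold cutOrder
  rw [crossing_lift G hA h, card_lift, card_lift, hc, Fintype.card_option, Fintype.card_coe]
  push_cast
  by_cases hP : none ∈ P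
  · have hQ : none ∉ Q := fun hQ => Finset.disjoint_left.1 h hP hQ
    simp only [hP, hQ, mem_union, if_true, if_false, true_or]
    ring
  · by_cases hQ : none ∈ Q <;> simp only [hP, hQ, mem_union, if_true, if_false, or_true, or_self]
      <;> ring

lemma valency_eq_crossing_compl {V : Type*} [Fintype V] [DecidableEq V] (G : SimpleGraph V)
    (v : V) :
    G.valency v = G.crossing {v} {v}ᶜ := by
  rw [← cutOrder_singleton_compl, cutOrder_compl]

lemma valency_collapse (hA : ∀ a ∈ A, G.crossing {a} Aᶜ ≤ 1) (p : Option A) :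
    (G.collapse A).valency p = G.crossing (fiber A p) (fiber A p)ᶜ := by
  rw [valency_eq_crossing_compl, ← crossing_lift G hA disjoint_compl_right, lift_compl]
  simp [lift]

lemma valency_collapse_some (hA : ∀ a ∈ A, G.crossing {a} Aᶜ ≤ 1) (a : A) :
    (G.collapse A).valency (some a) = G.valency a := by
  rw [valency_collapse G hA, valency_eq_crossing_compl]
  rfl

lemma valency_collapse_none (hA : ∀ a ∈ A, G.crossing {a} Aᶜ ≤ 1) :
    (G.collapse A).valency none = G.crossing A Aᶜ := by
  rw [valency_collapse G hA, crossing_comm]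
  simp [fiber]

lemma exists_lift_eq {X : Finset V} (hX : X ⊆ A ∨ Aᶜ ⊆ X) :
    ∃ P, lift A P = X := by
  refine ⟨({p | fiber A p ⊆ X} : Finset (Option A)), ?_⟩
  ext v
  simp only [lift, mem_biUnion, mem_filter, mem_univ, true_and]
  constructor
  · rintro ⟨p, hp, hv⟩
    exact hp hv
  · intro hv
    by_cases hvA : v ∈ A
    · exact ⟨some ⟨v, hvA⟩, by simpa [fiber] using hv, by simp [fiber]⟩
    · rcases hX with h | h
      · exact absurd (h hv) hvA
      · exact ⟨none, by simpa [fiber] using h, by simpa [fiber] using hvA⟩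

lemma mem_of_mem_lift {a : A} {P : Finset (Option A)} (h : a.1 ∈ lift A P) : some a ∈ P := by
  obtain ⟨p, hp, ha⟩ := mem_biUnion.1 h
  cases p with
  | none => exact absurd a.2 (mem_compl.1 ha)
  | some b =>
    rw [fiber, mem_singleton] at ha
    rwa [Subtype.ext ha]

lemma disjoint_of_disjoint_lift (hA : Aᶜ.Nonempty) {P Q : Finset (Option A)}
    (h : Disjoint (lift A P) (lift A Q)) : Disjoint P Q := by
  rw [Finset.disjoint_left]
  intro p hp hq
  obtain ⟨v, hv⟩ := lift_nonempty hA (singleton_nonempty p)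
  simp only [lift, singleton_biUnion] at hv
  exact Finset.disjoint_left.1 h (mem_biUnion.2 ⟨p, hp, hv⟩) (mem_biUnion.2 ⟨p, hq, hv⟩)

variable {G}

/-- Contracting one side of a cut of three independent edges preserves tightness. -/
lemma IsTight.collapse (hG : G.IsTight) (hA : ∀ a ∈ A, G.crossing {a} Aᶜ ≤ 1)
    (hne : Aᶜ.Nonempty) (h3 : G.crossing A Aᶜ = 3) : (G.collapse A).IsTight where
  three_le := by
    have hnone := (valency_collapse_none G hA).trans h3
    have key : ∀ P Q : Finset (Option A), Disjoint P Q → P.Nonempty → Q.Nonempty →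
        none ∈ P ∪ Q → 3 ≤ (G.collapse A).cutOrder P Q := by
      intro P Q h hP hQ hn
      have := cutOrder_lift G hA h
      rw [if_pos hn, add_zero] at this
      rw [← this]
      exact hG.three_le _ _ (disjoint_lift h) (lift_nonempty hne hP) (lift_nonempty hne hQ)
    intro P Q h hP hQ
    by_cases hn : none ∈ P ∪ Q
    · exact key P Q h hP hQ hn
    rw [mem_union, not_or] at hn
    have hle : (G.collapse A).crossing {none} P + (G.collapse A).crossing {none} Q ≤ 3 := by
      rw [← crossing_union_right _ _ h, ← hnone]
      exact crossing_mono _ (Subset.refl _) (subset_univ _)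
    -- The contracted vertex has degree 3, so it sends at most one edge to P or to Q; moving it to
    -- the opposite side does not increase the order.
    by_cases hQ1 : (G.collapse A).crossing {none} Q ≤ 1
    · have := key (insert none P) Q (by simp [hn.2, h]) (insert_nonempty _ _) hQ (by simp)
      rw [cutOrder_insert_left _ hn.1] at this
      linarith
    · have := key P (insert none Q) (by simp [hn.1, h]) hP (insert_nonempty _ _) (by simp)
      rw [cutOrder_insert_right _ hn.2] at this
      linarith
  exists_cut := by
    have hnone := (valency_collapse_none G hA).trans h3
    rintro (_ | a) (_ | b) hab hx hy
    · exact absurd rfl hab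
    · rw [hnone] at hx; norm_num at hx
    · rw [hnone] at hy; norm_num at hy
    rw [valency_collapse_some G hA] at hx hy
    have key : ∀ X Y : Finset V, Disjoint X Y → (X ⊆ A ∨ Aᶜ ⊆ X) → (Y ⊆ A ∨ Aᶜ ⊆ Y) →
        a.1 ∈ X → b.1 ∈ Y → G.cutOrder X Y ≤ 3 → ∃ P Q : Finset (Option A), Disjoint P Q ∧
          some a ∈ P ∧ some b ∈ Q ∧ (G.collapse A).cutOrder P Q ≤ 3 := by
      intro X Y hXY hX hY haX hbY hc
      obtain ⟨P, rfl⟩ := exists_lift_eq hX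
      obtain ⟨Q, rfl⟩ := exists_lift_eq hY
      have hPQ := disjoint_of_disjoint_lift hne hXY
      refine ⟨P, Q, hPQ, mem_of_mem_lift haX, mem_of_mem_lift hbY, ?_⟩
      rw [cutOrder_lift G hA hPQ] at hc
      have : (1 : ℤ) ≤ #Aᶜ := by exact_mod_cast card_pos.2 hne
      split_ifs at hc <;> linarith
    obtain ⟨P, Q, hPQ, ha, hb, hc⟩ :=
      hG.exists_cut a b (fun h => hab (congrArg some (Subtype.ext h))) hx hy
    have hcA := G.cutOrder_compl A
    -- Uncrossing with the cut (A, Aᶜ), also of order 3, makes the sides unions of fibers. The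
    -- companion cut has order at least 3, so the new one has order at most 3.
    by_cases hQ : (Q ∩ Aᶜ).Nonempty
    · refine key (P ∩ A) (Q ∪ Aᶜ) ?_ (.inl inter_subset_right) (.inr subset_union_right)
        (mem_inter.2 ⟨ha, a.2⟩) (mem_union_left _ hb) ?_
      · rw [disjoint_union_right]
        exact ⟨hPQ.mono_left inter_subset_left,
          disjoint_compl_right.mono_left inter_subset_right⟩
      · have h1 := G.cutOrder_inter_union_le P A Q Aᶜ
        have h2 := hG.three_le (P ∪ A) (Q ∩ Aᶜ) (by
          rw [disjoint_union_left]
          exact ⟨hPQ.mono_right inter_subset_left,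
            disjoint_compl_right.mono_right inter_subset_right⟩) ⟨a, mem_union_left _ ha⟩ hQ
        linarith
    by_cases hP : (P ∩ Aᶜ).Nonempty
    · refine key (P ∪ Aᶜ) (Q ∩ A) ?_ (.inr subset_union_right) (.inl inter_subset_right)
        (mem_union_left _ ha) (mem_inter.2 ⟨hb, b.2⟩) ?_
      · rw [disjoint_union_left]
        exact ⟨hPQ.mono_right inter_subset_left,
          disjoint_compl_left.mono_right inter_subset_right⟩
      · have h1 := G.cutOrder_inter_union_le Q A P Aᶜ
        have h2 := hG.three_le (Q ∪ A) (P ∩ Aᶜ) (by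
          rw [disjoint_union_left]
          exact ⟨hPQ.symm.mono_right inter_subset_left,
            disjoint_compl_right.mono_right inter_subset_right⟩) ⟨b, mem_union_left _ hb⟩ hP
        rw [cutOrder_comm] at hc ⊢
        linarith
    have hsub : ∀ X : Finset V, ¬(X ∩ Aᶜ).Nonempty → X ⊆ A := fun X hX v hv =>
      by_contra fun h => hX ⟨v, mem_inter.2 ⟨hv, mem_compl.2 h⟩⟩
    exact key P Q hPQ (.inl (hsub P hP)) (.inl (hsub Q hQ)) ha hb hc

lemma sum_collapse (hA : ∀ a ∈ A, G.crossing {a} Aᶜ ≤ 1) (h3 : G.crossing A Aᶜ = 3) :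
    ∑ p, (4 - (G.collapse A).valency p) = 1 + ∑ a ∈ A, (4 - G.valency a) := by
  rw [Fintype.sum_option, valency_collapse_none G hA, h3, ← sum_coe_sort A]
  simp only [valency_collapse_some G hA]
  ring

/-- Each vertex of a side containing a vertex of degree at least four is incident with at most
one edge of a cut of three edges. -/
lemma IsTight.crossing_singleton_compl_le_one (hG : G.IsTight) (h3 : G.crossing A Aᶜ = 3)
    (hne : Aᶜ.Nonempty) (hx : ∃ x ∈ A, 4 ≤ G.valency x) :
    ∀ a ∈ A, G.crossing {a} Aᶜ ≤ 1 := by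
  intro a ha
  by_contra! hlt
  have h1 := G.cutOrder_insert_left (A := A.erase a) (B := Aᶜ) (notMem_erase a A)
  rw [insert_erase ha, cutOrder_compl, h3] at h1
  have h2 : (A.erase a).Nonempty := by
    rw [nonempty_iff_ne_empty, Ne, erase_eq_empty_iff, not_or]
    refine ⟨ne_empty_of_mem ha, ?_⟩
    rintro rfl
    obtain ⟨x, hx, h4⟩ := hx
    obtain rfl := mem_singleton.1 hx
    rw [valency_eq_crossing_compl, h3] at h4
    norm_num at h4
  have := hG.three_le _ _ (disjoint_compl_right.mono_left (erase_subset a A)) h2 hne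
  linarith

lemma two_le_card_of_four_le_valency (h3 : G.crossing A Aᶜ = 3)
    (hx : ∃ x ∈ A, 4 ≤ G.valency x) : 2 ≤ #A := by
  obtain ⟨x, hxA, hx⟩ := hx
  by_contra! hlt
  obtain rfl : A = {x} := by
    refine (eq_of_subset_of_card_le (singleton_subset_iff.2 hxA) ?_).symm
    rw [card_singleton]
    omega
  rw [valency_eq_crossing_compl, h3] at hx
  norm_num at hx

/-! ### The lower bound on the sum of 4 - deg v -/

lemma IsTight.sum_eq_of_unique [Nontrivial V] (hG : G.IsTight) {x : V}
    (hx : ∀ v, v ≠ x → G.valency v < 4) :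
    ∑ v, (4 - G.valency v) = 4 + (Fintype.card V - 1 - G.valency x) := by
  have h1 : ∀ v ∈ univ.erase x, 4 - G.valency v = 1 := by
    intro v hv
    have := hx v (ne_of_mem_erase hv)
    have := hG.three_le_valency v
    linarith
  rw [← add_sum_erase _ _ (mem_univ x), sum_congr rfl h1, sum_const, card_erase_of_mem (mem_univ x),
    card_univ, nsmul_one, Nat.cast_sub Fintype.card_pos]
  push_cast
  ring

/-- The bound 4 drives the induction; the stronger bound 6 excludes a second vertex of degree at
least 4 in the equality case. -/
lemma IsTight.sum_bounds : ∀ (n : ℕ) {V : Type u} [Fintype V] [Nontrivial V] {G : SimpleGraph V},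
    Fintype.card V = n → G.IsTight → 4 ≤ ∑ v, (4 - G.valency v) ∧
      ∀ x y, x ≠ y → 4 ≤ G.valency x → 4 ≤ G.valency y → 6 ≤ ∑ v, (4 - G.valency v) := by
  intro n
  induction n using Nat.strong_induction_on with
  | _ n ih =>
  intro V _ _ G hn hG
  have hsix : ∀ x y, x ≠ y → 4 ≤ G.valency x → 4 ≤ G.valency y →
      6 ≤ ∑ v, (4 - G.valency v) := by
    intro x y hxy hx hy
    obtain ⟨A, hA, hB, h3⟩ := hG.exists_edge_cut hxy hx hy
    have key : ∀ A : Finset V, (∃ x ∈ A, 4 ≤ G.valency x) → (∃ y ∈ Aᶜ, 4 ≤ G.valency y) →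
        G.crossing A Aᶜ = 3 → 3 ≤ ∑ a ∈ A, (4 - G.valency a) := by
      intro A hA hB h3
      have hne : Aᶜ.Nonempty := hB.imp fun _ h => h.1
      have h1 := hG.crossing_singleton_compl_le_one h3 hne hA
      -- At least two vertices are contracted, so the new graph is strictly smaller.
      have h2 := two_le_card_of_four_le_valency (A := Aᶜ)
        (by rw [compl_compl, crossing_comm, h3]) hB
      have hcard := card_add_card_compl A
      have : Nonempty A := hA.elim fun a h => ⟨⟨a, h.1⟩⟩
      have := (ih (Fintype.card (Option A))
        (by rw [Fintype.card_option, Fintype.card_coe]; omega) rfl (hG.collapse h1 hne h3)).1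
      rw [sum_collapse h1 h3] at this
      linarith
    have h1 := key A hA hB h3
    have h2 := key Aᶜ hB (by rwa [compl_compl]) (by rw [compl_compl, crossing_comm, h3])
    rw [← sum_add_sum_compl A]
    linarith
  refine ⟨?_, hsix⟩
  by_cases h : ∃ x y, x ≠ y ∧ 4 ≤ G.valency x ∧ 4 ≤ G.valency y
  · obtain ⟨x, y, hxy, hx, hy⟩ := h
    linarith [hsix x y hxy hx hy]
  push Not at h
  obtain ⟨x, hx⟩ : ∃ x, ∀ v, v ≠ x → G.valency v < 4 := by
    by_cases h' : ∃ x, 4 ≤ G.valency x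
    · obtain ⟨x, hx⟩ := h'
      exact ⟨x, fun v hv => h x v hv.symm hx⟩
    · push Not at h'
      exact ⟨Classical.arbitrary V, fun v _ => h' v⟩
  rw [hG.sum_eq_of_unique hx]
  linarith [G.valency_le_card_sub_one x]

/-- In the extremal case there is a vertex adjacent to all others, which have degree three. -/
lemma IsTight.exists_hub [Nontrivial V] (hG : G.IsTight) (h : ∑ v, (4 - G.valency v) = 4) :
    ∃ x, G.valency x = Fintype.card V - 1 ∧ ∀ v, v ≠ x → G.valency v = 3 := by
  obtain ⟨x, hx⟩ : ∃ x, ∀ v, v ≠ x → G.valency v < 4 := by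
    by_cases h' : ∃ x, 4 ≤ G.valency x
    · obtain ⟨x, hx⟩ := h'
      refine ⟨x, fun v hv => ?_⟩
      by_contra! hv4
      have := (IsTight.sum_bounds _ rfl hG).2 v x hv hv4 hx
      linarith
    · push Not at h'
      exact ⟨Classical.arbitrary V, fun v _ => h' v⟩
  rw [hG.sum_eq_of_unique hx] at h
  refine ⟨x, by linarith, fun v hv => ?_⟩
  have := hx v hv
  have := hG.three_le_valency v
  linarith

end Collapse

/-! ### Wheels and the case of equality -/

section Wheel

open Finset
open scoped Classical

lemma valency_eq_card {V : Type*} [Fintype V] (G : SimpleGraph V) (v : V) :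
    G.valency v = #{w | G.Adj v w} := crossing_singleton_left G v univ

lemma valency_eq_degree {V : Type*} [Fintype V] (G : SimpleGraph V) (v : V) :
    G.valency v = G.degree v := by
  rw [valency_eq_card, ← card_neighborFinset_eq_degree, neighborFinset_eq_filter]

lemma sum_four_sub_valency {V : Type*} [Fintype V] (G : SimpleGraph V) [Fintype G.edgeSet] :
    ∑ v, (4 - G.valency v) = 4 * Fintype.card V - 2 * #G.edgeFinset := by
  simp only [valency_eq_degree]
  rw [sum_sub_distrib, ← Nat.cast_sum, sum_degrees_eq_twice_card_edges, sum_const, card_univ]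
  push_cast
  simp only [nsmul_eq_mul, mul_comm]
  congr!

/-- Mixed cuts with a dominating vertex on one side have order at least three if all degrees
are at least three. -/
lemma three_le_cutOrder_of_mem {V : Type*} [Fintype V] {G : SimpleGraph V} {x : V}
    (hx : ∀ v, v ≠ x → G.Adj x v) (hdeg : ∀ v, v ≠ x → 3 ≤ G.valency v) {P Q : Finset V}
    (hPQ : Disjoint P Q) (hxP : x ∈ P) (hQ : Q.Nonempty) : 3 ≤ G.cutOrder P Q := by
  obtain ⟨q, hq⟩ := hQ
  have hxQ : x ∉ Q := fun h => Finset.disjoint_left.1 hPQ hxP h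
  have hqx : q ≠ x := fun h => hxQ (h ▸ hq)
  have h1 : G.valency q = G.crossing {q} (P.erase x) + 1 + G.crossing {q} (Q.erase q) +
      G.crossing {q} (P ∪ Q)ᶜ := by
    rw [G.valency_eq_add_compl q (P ∪ Q), crossing_union_right _ _ hPQ]
    have e1 : P = P.erase x ∪ {x} := by rw [union_comm, ← insert_eq, insert_erase hxP]
    have e2 : Q = Q.erase q ∪ {q} := by rw [union_comm, ← insert_eq, insert_erase hq]
    have e3 : G.crossing {q} P = G.crossing {q} (P.erase x) + 1 := by
      conv_lhs => rw [e1]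
      rw [crossing_union_right _ _ (by simp), crossing_singleton_singleton,
        if_pos (hx q hqx).symm]
    have e4 : G.crossing {q} Q = G.crossing {q} (Q.erase q) := by
      conv_lhs => rw [e2]
      rw [crossing_union_right _ _ (by simp), crossing_singleton_self, add_zero]
    rw [e3, e4]
  have h2 : (#Q : ℤ) = G.crossing {x} Q := by
    rw [crossing_singleton_left, filter_true_of_mem]
    exact fun v hv => hx v fun h => hxQ (h ▸ hv)
  -- The #Q edges from x to Q pay for the edge qx and the neighbours of q inside Q; the other edges
  -- at q go to P or to vertices outside both sides. Thus the order is at least deg q.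
  have h3 : G.crossing {x} Q + G.crossing (P.erase x) {q} ≤ G.crossing P Q := by
    have e1 : {x} ∪ P.erase x = P := by rw [← insert_eq, insert_erase hxP]
    rw [← e1, crossing_union_left _ (by simp)]
    rw [e1]
    linarith [G.crossing_mono (Subset.refl (P.erase x)) (singleton_subset_iff.2 hq)]
  have h4 := G.crossing_singleton_left_le_card (Q.erase q) q
  have h5 := G.crossing_singleton_left_le_card (P ∪ Q)ᶜ q
  rw [card_erase_of_mem hq, Nat.cast_sub (card_pos.2 ⟨q, hq⟩)] at h4
  rw [card_compl, Nat.cast_sub (card_le_univ _), card_union_of_disjoint hPQ] at h5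
  have h6 := hdeg q hqx
  rw [G.crossing_comm (P.erase x)] at h3
  unfold cutOrder
  push_cast at h4 h5
  linarith

lemma wheelGraph_adj_none {n : ℕ} (v : Option (Fin n)) (hv : v ≠ none) :
    (wheelGraph n).Adj none v := by
  cases v with
  | none => exact absurd rfl hv
  | some i => trivial

lemma wheelGraph_adj_some {k : ℕ} {i j : Fin (k + 3)} :
    (wheelGraph (k + 3)).Adj (some i) (some j) ↔ i - j = 1 ∨ j - i = 1 := Iff.rfl

lemma valency_wheelGraph_some {k : ℕ} (i : Fin (k + 3)) :
    (wheelGraph (k + 3)).valency (some i) = 3 := by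
  have h : ({w | (wheelGraph (k + 3)).Adj (some i) w} : Finset (Option (Fin (k + 3)))) =
      insertNone ((cycleGraph (k + 3)).neighborFinset i) := by
    ext w
    cases w with
    | none => simpa using (wheelGraph_adj_none (some i) (by simp)).symm
    | some j =>
      simp only [mem_filter, mem_univ, true_and, some_mem_insertNone, mem_neighborFinset]
      rfl
  rw [valency_eq_card, h, card_insertNone, card_neighborFinset_eq_degree,
    cycleGraph_degree_three_le]
  rfl

lemma valency_wheelGraph_none (n : ℕ) : (wheelGraph n).valency none = n := by
  have h : ({w | (wheelGraph n).Adj none w} : Finset (Option (Fin n))) = univ.erase none := by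
    ext w
    simp only [mem_filter, mem_univ, true_and, mem_erase, and_true]
    exact ⟨fun h => h.ne', wheelGraph_adj_none w⟩
  rw [valency_eq_card, h, card_erase_of_mem (mem_univ _), card_univ]
  simp

open Fin.NatCast Fin.CommRing in
/-- Going around a cycle, a proper nonempty set of vertices is left somewhere. -/
lemma exists_mem_add_one_notMem {k : ℕ} {P : Fin (k + 3) → Prop} {i j : Fin (k + 3)} (hi : P i)
    (hj : ¬P j) : ∃ l, P l ∧ ¬P (l + 1) := by
  by_contra! h
  have key : ∀ m : ℕ, P (i + (m : Fin (k + 3))) := by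
    intro m
    induction m with
    | zero => simpa using hi
    | succ m ih =>
      have := h _ ih
      rwa [add_assoc, ← Nat.cast_succ] at this
  have := key (j - i).val
  rw [Fin.cast_val_eq_self, add_sub_cancel] at this
  exact hj this

lemma three_le_cutOrder_wheelGraph {k : ℕ} {P Q : Finset (Option (Fin (k + 3)))}
    (hPQ : Disjoint P Q) (hP : P.Nonempty) (hQ : Q.Nonempty) :
    3 ≤ (wheelGraph (k + 3)).cutOrder P Q := by
  have hdeg : ∀ v, v ≠ none → 3 ≤ (wheelGraph (k + 3)).valency v := by
    intro v hv
    obtain ⟨i, rfl⟩ := Option.ne_none_iff_exists'.1 hv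
    rw [valency_wheelGraph_some]
  by_cases hnP : none ∈ P
  · exact three_le_cutOrder_of_mem wheelGraph_adj_none hdeg hPQ hnP hQ
  by_cases hnQ : none ∈ Q
  · rw [cutOrder_comm]
    exact three_le_cutOrder_of_mem wheelGraph_adj_none hdeg hPQ.symm hnQ hP
  obtain ⟨p, hp⟩ := hP
  obtain ⟨q, hq⟩ := hQ
  obtain ⟨p, rfl⟩ := Option.ne_none_iff_exists'.1 fun h => hnP (h ▸ hp)
  obtain ⟨q, rfl⟩ := Option.ne_none_iff_exists'.1 fun h => hnQ (h ▸ hq)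
  have hd : ∀ {v}, v ∈ P → v ∉ Q := fun h => Finset.disjoint_left.1 hPQ h
  -- The hub lies outside both sides and counts once. The places where the rim leaves P and leaves Q
  -- each give a further outside vertex or crossing edge, and these are distinct.
  obtain ⟨i, hi, hi'⟩ := exists_mem_add_one_notMem (P := fun l => some l ∈ P) hp
    (fun h => hd h hq)
  obtain ⟨j, hj, hj'⟩ := exists_mem_add_one_notMem (P := fun l => some l ∈ Q) hq (hd hp)
  have hij : i ≠ j := fun h => hd hi (h ▸ hj)
  rw [cutOrder_eq_card_add_card hPQ]
  set Z := (P ∪ Q)ᶜ with hZ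
  set E : Finset (Option (Fin (k + 3)) × Option (Fin (k + 3))) :=
    {e ∈ P ×ˢ Q | (wheelGraph (k + 3)).Adj e.1 e.2} with hE
  have hZn : none ∈ Z := by simp [hZ, hnP, hnQ]
  have hEi : some (i + 1) ∈ Q → (some i, some (i + 1)) ∈ E := fun h => by
    simp [hE, hi, h, wheelGraph_adj_some]
  have hEj : some (j + 1) ∈ P → (some (j + 1), some j) ∈ E := fun h => by
    simp [hE, hj, h, wheelGraph_adj_some]
  suffices 3 ≤ #Z + #E by exact_mod_cast this
  by_cases h1 : some (i + 1) ∈ Q <;> by_cases h2 : some (j + 1) ∈ P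
  · have e1 : 0 < #Z := card_pos.2 ⟨_, hZn⟩
    have e2 : 1 < #E := by
      refine one_lt_card.2 ⟨_, hEi h1, _, hEj h2, fun h => ?_⟩
      simp only [Prod.mk.injEq, Option.some.injEq] at h
      have h3 := h.2
      rw [h.1, add_assoc, add_eq_left] at h3
      -- The two crossing edges coincide only if 2 = 0 modulo the rim length, which is at least 3.
      exact absurd h3 (ne_of_beq_false rfl)
    omega
  · have e1 : 1 < #Z := one_lt_card.2 ⟨_, hZn, some (j + 1), by simp [hZ, h2, hj'], by simp⟩
    have e2 : 0 < #E := card_pos.2 ⟨_, hEi h1⟩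
    omega
  · have e1 : 1 < #Z := one_lt_card.2 ⟨_, hZn, some (i + 1), by simp [hZ, h1, hi'], by simp⟩
    have e2 : 0 < #E := card_pos.2 ⟨_, hEj h2⟩
    omega
  · have e1 : 2 < #Z := two_lt_card.2 ⟨_, hZn, some (i + 1), by simp [hZ, h1, hi'],
      some (j + 1), by simp [hZ, h2, hj'], by simp, by simp, by simpa using hij⟩
    omega

lemma isUniformlyConnected_wheelGraph (k : ℕ) :
    (wheelGraph (k + 3)).IsUniformlyConnected 3 := by
  intro u v huv
  refine ⟨hasInternallyDisjointPaths_of_le_cutOrder huv fun A B hAB hu hv =>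
    three_le_cutOrder_wheelGraph hAB ⟨u, hu⟩ ⟨v, hv⟩, fun n hn => ?_⟩
  suffices (n : ℤ) ≤ 3 by exact_mod_cast this
  rcases u with _ | i
  · rcases v with _ | j
    · exact absurd rfl huv
    · rw [← valency_wheelGraph_some j, ← cutOrder_singleton_compl, cutOrder_comm]
      exact HasInternallyDisjointPaths.le_cutOrder hn disjoint_compl_left (by simp) (by simp)
  · rw [← valency_wheelGraph_some i, ← cutOrder_singleton_compl]
    exact HasInternallyDisjointPaths.le_cutOrder hn disjoint_compl_right (by simp)
      (by simpa using huv.symm)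

lemma HasInternallyDisjointPaths.map {V W : Type*} {G : SimpleGraph V} {H : SimpleGraph W}
    (f : G ↪g H) {u v : V} {n : ℕ} (h : G.HasInternallyDisjointPaths u v n) :
    H.HasInternallyDisjointPaths (f u) (f v) n := by
  obtain ⟨P, hinj, hdis⟩ := h
  refine ⟨fun i => (P i).mapEmbedding f, fun i j hij =>
    hinj (Path.mapEmbedding_injective f u v hij), fun i j hij x hxi hxj => ?_⟩
  simp only [Path.mapEmbedding_coe, Walk.support_map, List.mem_map] at hxi hxj
  obtain ⟨y, hy, rfl⟩ := hxi
  obtain ⟨z, hz, hzy⟩ := hxj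
  obtain rfl : z = y := f.injective hzy
  rcases hdis hij z hy hz with rfl | rfl
  · exact .inl rfl
  · exact .inr rfl

lemma IsUniformlyConnected.of_iso {V W : Type*} {G : SimpleGraph V} {H : SimpleGraph W}
    (e : G ≃g H) {k : ℕ} (hH : H.IsUniformlyConnected k) : G.IsUniformlyConnected k := by
  intro u v huv
  obtain ⟨h1, h2⟩ := hH (e u) (e v) (e.injective.ne huv)
  refine ⟨?_, fun n hn => h2 (HasInternallyDisjointPaths.map e.toEmbedding hn)⟩
  have := HasInternallyDisjointPaths.map e.symm.toEmbedding h1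
  simpa using this

lemma IsWheel.isUniformlyConnected {V : Type*} {G : SimpleGraph V} (hG : G.IsWheel) :
    G.IsUniformlyConnected 3 := by
  obtain ⟨n, hn, ⟨e⟩⟩ := hG
  obtain ⟨k, rfl⟩ := Nat.exists_eq_add_of_le' hn
  exact (isUniformlyConnected_wheelGraph k).of_iso e

lemma IsWheel.card_edgeFinset {V : Type*} [Fintype V] {G : SimpleGraph V} [Fintype G.edgeSet]
    (hG : G.IsWheel) : (#G.edgeFinset : ℤ) = 2 * Fintype.card V - 2 := by
  obtain ⟨n, hn, ⟨e⟩⟩ := hG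
  obtain ⟨k, rfl⟩ := Nat.exists_eq_add_of_le' hn
  have h := sum_four_sub_valency (wheelGraph (k + 3))
  rw [Fintype.sum_option, valency_wheelGraph_none] at h
  simp only [valency_wheelGraph_some] at h
  rw [← e.card_edgeFinset_eq, ← Fintype.card_congr e.toEquiv] at h
  have hV := Fintype.card_congr e.toEquiv
  rw [Fintype.card_option, Fintype.card_fin] at hV
  simp only [sum_const, card_univ, Fintype.card_fin, hV] at h ⊢
  push_cast at h ⊢
  simp at h
  linarith

/-- A connected 2-regular graph is a cycle. -/
lemma nonempty_iso_cycleGraph {V : Type*} [Fintype V] [Nonempty V] {G : SimpleGraph V}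
    (hG : G.Preconnected) (hdeg : ∀ v, (G.neighborSet v).ncard = 2)
    (hcard : 2 < Fintype.card V) : Nonempty (cycleGraph (Fintype.card V) ≃g G) := by
  have hcyc : G.IsCycles := fun v _ => hdeg v
  obtain ⟨v⟩ := ‹Nonempty V›
  obtain ⟨p, hp, hverts⟩ := hcyc.exists_cycle_toSubgraph_verts_eq_connectedComponentSupp
    (c := G.connectedComponentMk v) (v := v) rfl
    (Set.nonempty_of_ncard_ne_zero (by rw [hdeg]; norm_num))
  have hlen : p.length = Fintype.card V := by
    have hall : p.support.tail.toFinset = univ := by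
      ext w
      simp only [List.mem_toFinset, mem_univ, iff_true]
      have : w ∈ p.toSubgraph.verts := by
        rw [hverts, ConnectedComponent.mem_supp_iff, ConnectedComponent.eq]
        exact hG w v
      rw [Walk.mem_verts_toSubgraph] at this
      rcases (Walk.mem_support_iff p).1 this with rfl | h
      · exact Walk.end_mem_tail_support hp.not_nil
      · exact h
    have := List.toFinset_card_of_nodup hp.support_nodup
    rw [hall, card_univ, List.length_tail, Walk.length_support] at this
    omega
  -- The spanning cycle embeds the cycle graph bijectively on vertices; as both graphs are
  -- 2-regular, no edge of `G` is left over.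
  obtain ⟨f⟩ := (cycleGraph_isContained_iff hcard).2 ⟨v, p, hp, hlen⟩
  have hbij : Function.Bijective f :=
    (Fintype.bijective_iff_injective_and_card f).2 ⟨f.injective, Fintype.card_fin _⟩
  refine ⟨⟨Equiv.ofBijective f hbij, fun {i j} => ⟨fun h => ?_, fun h => f.toHom.map_adj h⟩⟩⟩
  have hsub : f '' (cycleGraph (Fintype.card V)).neighborSet i ⊆ G.neighborSet (f i) := by
    rintro _ ⟨l, hl, rfl⟩
    exact f.toHom.map_adj hl
  have hn : ((cycleGraph (Fintype.card V)).neighborSet i).ncard = 2 := by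
    rw [Set.ncard_eq_toFinset_card', ← neighborFinset_def, card_neighborFinset_eq_degree]
    obtain ⟨k, hk⟩ := Nat.exists_eq_add_of_le' hcard
    have : ∀ n, n = k + 3 → ∀ i : Fin n, (cycleGraph n).degree i = 2 := by
      rintro n rfl i
      exact cycleGraph_degree_three_le
    convert this _ hk i
  have heq := Set.eq_of_subset_of_ncard_le hsub
    (by rw [hdeg]; exact (hn.symm.trans (Set.ncard_image_of_injective _ f.injective).symm).le)
    (Set.toFinite _)
  have hj : f j ∈ G.neighborSet (f i) := h
  rw [← heq] at hj
  obtain ⟨l, hl, hlj⟩ := hj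
  rwa [← f.injective hlj]

lemma IsTight.isWheel {V : Type*} [Fintype V] [Nontrivial V] {G : SimpleGraph V}
    (hG : G.IsTight) {x : V} (hx : G.valency x = Fintype.card V - 1)
    (h3 : ∀ v, v ≠ x → G.valency v = 3) : G.IsWheel := by
  have hadj : ∀ v, v ≠ x → G.Adj x v := by
    have hsub : ({w | G.Adj x w} : Finset V) ⊆ univ.erase x := fun w hw => by
      simp only [mem_filter, mem_univ, true_and] at hw
      simpa using hw.ne'
    have := eq_of_subset_of_card_le hsub (by
      rw [valency_eq_card] at hx
      rw [card_erase_of_mem (mem_univ _), card_univ]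
      omega)
    intro v hv
    have hv' : v ∈ univ.erase x := by simpa using hv
    rw [← this] at hv'
    simpa using hv'
  let H : SimpleGraph {v : V // v ≠ x} := G.comap Subtype.val
  have hc : Fintype.card {v : V // v ≠ x} = Fintype.card V - 1 := by
    rw [Fintype.card_subtype_compl, Fintype.card_subtype_eq]
  have hc3 : 2 < Fintype.card {v : V // v ≠ x} := by
    have := hG.three_le_valency x
    omega
  have hne : Nonempty {v : V // v ≠ x} := Fintype.card_pos_iff.1 (by omega)
  have hdeg : ∀ v, (H.neighborSet v).ncard = 2 := by
    intro v
    have e1 : Subtype.val '' H.neighborSet v =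
        (({w | G.Adj v w} : Finset V).erase x : Finset V) := by
      ext w
      simp only [Set.mem_image, mem_neighborSet, Subtype.exists, exists_and_right, exists_eq_right,
        coe_erase, coe_filter, mem_univ, true_and, Set.mem_sdiff, Set.mem_ofPred_eq,
        Set.mem_singleton_iff, H, comap_adj]
      tauto
    rw [← Set.ncard_image_of_injective _ Subtype.val_injective, e1, Set.ncard_coe_finset,
      card_erase_of_mem (by simpa using (hadj v v.2).symm)]
    have := h3 v v.2
    rw [valency_eq_card] at this
    omega
  have hconn : H.Preconnected := by
    intro u v
    by_contra hcon
    let P : Finset V := ({w | H.Reachable u w} : Finset {v : V // v ≠ x}).map (.subtype _)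
    let Q : Finset V := ({w | ¬H.Reachable u w} : Finset {v : V // v ≠ x}).map (.subtype _)
    have hPQ : Disjoint P Q := by
      rw [disjoint_map]
      exact disjoint_filter_filter_not _ _ _
    have h := hG.three_le P Q hPQ ⟨u, by simpa [P] using u.2⟩
      ⟨v, by simpa [Q] using ⟨v.2, hcon⟩⟩
    have h0 : G.crossing P Q = 0 := by
      refine sum_eq_zero fun a ha => sum_eq_zero fun b hb => if_neg fun hab => ?_
      simp only [P, Q, mem_map, mem_filter, mem_univ, true_and] at ha hb
      obtain ⟨a, ha, rfl⟩ := ha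
      obtain ⟨b, hb, rfl⟩ := hb
      exact hb (ha.trans (Adj.reachable (show H.Adj a b from hab)))
    have hcard : #P + #Q = Fintype.card V - 1 := by
      rw [card_map, card_map, card_filter_add_card_filter_not, card_univ, hc]
    -- Only x lies outside P ∪ Q and no edge crosses, so this cut would have order 1.
    unfold cutOrder at h
    omega
  obtain ⟨e⟩ := nonempty_iso_cycleGraph hconn hdeg hc3
  let φ : Option (Fin (Fintype.card {v : V // v ≠ x})) ≃ V :=
    (Equiv.optionCongr e.toEquiv).trans (Equiv.optionSubtypeNe x)
  have hφ : ∀ i, φ (some i) = (e i).1 := fun i => by simp [φ]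
  have hφn : φ none = x := by simp [φ]
  refine ⟨_, hc3, ⟨RelIso.symm ⟨φ, fun {a b} => ?_⟩⟩⟩
  rcases a with _ | i <;> rcases b with _ | j
  · rw [hφn]
    exact iff_of_false G.irrefl (wheelGraph _).irrefl
  · rw [hφn, hφ]
    exact iff_of_true (hadj _ (e j).2) trivial
  · rw [hφn, hφ]
    exact iff_of_true (hadj _ (e i).2).symm trivial
  · rw [hφ, hφ]
    exact e.map_adj_iff

end Wheel

end SimpleGraph

theorem mainTheorem5 {V : Type*} [Fintype V] [Nontrivial V] (G : SimpleGraph V)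
    [Fintype G.edgeSet] :
    (G.IsUniformlyConnected 3 →
      (G.edgeFinset.card : ℤ) ≤ 2 * (Fintype.card V : ℤ) - 2 ∧
      ((G.edgeFinset.card : ℤ) = 2 * (Fintype.card V : ℤ) - 2 ↔ G.IsWheel)) ∧
    (G.IsWheel → G.IsUniformlyConnected 3) := by
  refine ⟨fun hG => ⟨?_, fun h => ?_, SimpleGraph.IsWheel.card_edgeFinset⟩,
    SimpleGraph.IsWheel.isUniformlyConnected⟩
  · have h := (SimpleGraph.IsTight.sum_bounds _ rfl hG.isTight).1
    rw [SimpleGraph.sum_four_sub_valency] at h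
    linarith
  · have hs := SimpleGraph.sum_four_sub_valency G
    obtain ⟨x, hx, h3⟩ := hG.isTight.exists_hub (by rw [hs, h]; ring)
    exact hG.isTight.isWheel hx h3
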